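/- Let $0<a_1<a_2<a_3$ and let $c\in(a_1,a_3)$, $c\neq a_2$. Write $\{a_1,a_2,a_3,c\}=\{b_1<b_2<b_3<b_4\}$, $f_i=1/b_i$, and let \[\Gamma:\ \mu^2=-\lambda\prod_{k=1}^4(\lambda-b_k),\qquad P_0=(0,0)\in\Gamma,\] be the genus 2 curve attached to the geodesics on the ellipsoid $X_1^2/a_1+X_2^2/a_2+X_3^2/a_3=1$ that are tangent to the confocal quadric $\sum_i X_i^2/(a_i-c)=1$. Put $\omega_j=\lambda^{j-1}d\lambda/\mu$ ($j=1,2$), and let $\alpha_1,\alpha_2$ be the real ovals of $\Gamma$ over $[b_1,b_2]$ and $[b_3,b_4]$, oriented so that \[\oint_{\alpha_1}\omega_j=2\int_{b_1}^{b_2}\frac{\lambda^{j-1}d\lambda}{\sqrt{-\lambda\prod_k(\lambda-b_k)}},\qquad \oint_{\alpha_2}\omega_j=2\int_{b_3}^{b_4}\frac{\lambda^{j-1}d\lambda}{\sqrt{-\lambda\prod_k(\lambda-b_k)}}.\] The period mapping is $\varphi(c)=\oint_{\alpha_2}\omega_2:\oint_{\alpha_1}\omega_2$ if $c<a_2$,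 and $\varphi(c)=\oint_{\alpha_1}\omega_2:\oint_{\alpha_2}\omega_2$ if $c>a_2$. The real geodesics attached to $\Gamma$ are closed if and only if there are integers $(m_1,m_2)\ne(0,0)$ and a real $T>0$ with \[m_1\oint_{\alpha_1}\omega_1+m_2\oint_{\alpha_2}\omega_1=T,\qquad m_1\oint_{\alpha_1}\omega_2+m_2\oint_{\alpha_2}\omega_2=0;\tag{P}\] (P) is called the real periodicity condition. Assume that $(\Gamma,P_0)$ is a real hyperelliptic tangential cover of degree 4: there is a covering $\pi:\Gamma\to\mathcal E$ of degree $4$ onto an elliptic curve $\mathcal E:\ W^2=4Z^3-g_2Z-g_3$ with $g_2,g_3\in\mathbb R$ that maps $P_0$ to the point at infinity $Q_0$ of $\mathcal E$, and the image of $\mathcal E\to{\rm Jac}(\Gamma)$, $Q\mapsto\pi^*(Q-Q_0)$, is tangent at the origin to the image of $\Gamma$ under the Abel map with base point $P_0$. Consider the conditions \[(A)\quad\begin{cases}81(f_2^2+f_3^2)+62f_2f_3+36(f_1+f_4)^2-108(f_2+f_3)(f_1+f_4)=0,\\ 81(f_1^2+f_4^2)+62f_1f_4+36(f_2+f_3)^2-108(f_2+f_3)(f_1+f_4)=0,\end{cases}\]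 \[(B)\quad\begin{cases}100f_4f_3+8f_1(f_4+f_3+8f_1-9f_2)-(9f_4+9f_3-6f_2)^2=0,\\ (6f_4+6f_3-9f_2)^2+8f_1(9f_4+9f_3-8f_1-f_2)=0.\end{cases}\] If (A) holds, then (P) holds and the period mapping is $3:1$ or $1:3$; precisely, $\varphi(c)=3$ if $c<a_2$ and $\varphi(c)=1/3$ if $c>a_2$. If (B) holds, then (P) holds and the period mapping is $2:1$ or $1:2$; precisely, $\varphi(c)=2$ if $c<a_2$ and $\varphi(c)=1/2$ if $c>a_2$. -/

import Mathlib

open Polynomial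

noncomputable section

/-- The finite nonzero branch points `b₁ < b₂ < b₃ < b₄` (with indices `0, 1, 2, 3`) attached to
the ellipsoid `X₁²/a₁ + X₂²/a₂ + X₃²/a₃ = 1` and to the caustic parameter `c`, that is, the numbers
`a₁, a₂, a₃, c` in increasing order when `0 < a₁ < a₂ < a₃`, `a₁ < c < a₃`, `c ≠ a₂`. -/
def branchPoints (a₁ a₂ a₃ c : ℝ) : Fin 4 → ℝ :=
  if c < a₂ then ![a₁, c, a₂, a₃] else ![a₁, a₂, c, a₃]

/-- The polynomial `-λ (λ - b₁) (λ - b₂) (λ - b₃) (λ - b₄)`; the curve `Γ` is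
`μ² = curvePoly b`, and `P₀ = (0, 0)` is its marked point. -/
def curvePoly (b : Fin 4 → ℝ) : ℝ[X] :=
  -(X * ∏ i, (X - C (b i)))

/-- The period of `ω_j = λ^(j-1) dλ / μ` over the real oval `α₁` of `Γ`, which lies over
`[b₁, b₂]` and is oriented so that `dλ / μ` is positive. -/
def alphaPeriod₁ (b : Fin 4 → ℝ) (j : ℕ) : ℝ :=
  2 * ∫ x in (b 0)..(b 1), x ^ (j - 1) / Real.sqrt ((curvePoly b).eval x)

/-- The period of `ω_j = λ^(j-1) dλ / μ` over the real oval `α₂` of `Γ`, which lies over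
`[b₃, b₄]` and is oriented so that `dλ / μ` is positive. -/
def alphaPeriod₂ (b : Fin 4 → ℝ) (j : ℕ) : ℝ :=
  2 * ∫ x in (b 2)..(b 3), x ^ (j - 1) / Real.sqrt ((curvePoly b).eval x)

/-- The real periodicity condition, which characterizes closedness of the real geodesics attached to
the curve `Γ`. -/
def RealPeriodicity (b : Fin 4 → ℝ) : Prop :=
  ∃ (m₁ m₂ : ℤ) (T : ℝ), (m₁, m₂) ≠ (0, 0) ∧ 0 < T ∧
    m₁ * alphaPeriod₁ b 1 + m₂ * alphaPeriod₂ b 1 = T ∧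
    m₁ * alphaPeriod₁ b 2 + m₂ * alphaPeriod₂ b 2 = 0

/-- The period mapping `φ(c)` of the ellipsoid with squared semiaxes `a₁ < a₂ < a₃`. -/
def periodMapping (a₁ a₂ a₃ c : ℝ) : ℝ :=
  if c < a₂ then
    (2 * alphaPeriod₂ (branchPoints a₁ a₂ a₃ c) 2) / (2 * alphaPeriod₁ (branchPoints a₁ a₂ a₃ c) 2)
  else
    (2 * alphaPeriod₁ (branchPoints a₁ a₂ a₃ c) 2) / (2 * alphaPeriod₂ (branchPoints a₁ a₂ a₃ c) 2)

/-- The value at `x` of the derivative of the rational function `R`. -/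
def ratFuncDerivEval (R : RatFunc ℂ) (x : ℂ) : ℂ :=
  (R.num.derivative.eval x * R.denom.eval x - R.num.eval x * R.denom.derivative.eval x) /
    (R.denom.eval x) ^ 2

/-- `(Γ, P₀)` is a real hyperelliptic tangential cover of degree `N`: there is a covering
`π : Γ → 𝓔` of degree `N` onto an elliptic curve `𝓔 : W² = 4 Z³ - g₂ Z - g₃` with `g₂, g₃` real,
which maps `P₀` to the point at infinity of `𝓔` and is such that the image of
`𝓔 → Jac Γ, Q ↦ π^* (Q - π P₀)`, is tangent at the origin to `Γ ⊂ Jac Γ`.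

Since `P₀` is fixed by the hyperelliptic involution, `π` takes this involution to `W ↦ -W`, so that
`π (λ, μ) = (R λ, μ * S λ)` with rational functions `R, S`, and the degree of `π` is that of `R`.
The tangent of `Γ` at the origin is the direction `(1, 0)` in the coordinates dual to `ω₁, ω₂`;
the tangent of the image of `𝓔` has the coordinates `Tr_π ω₁, Tr_π ω₂` (divided by `dZ / W`). The
tangency therefore says `Tr_π (λ dλ / μ) = 0`. Over a generic point `(z, W)` the fibre of `π` is
`{(x, W / S x) : R x = z}`, and the trace there is `∑ x * S x / R' x` times `dZ / W`. -/
def IsRealTangentialCover (b : Fin 4 → ℝ) (N : ℕ) : Prop :=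
  ∃ (g₂ g₃ : ℝ) (R S : RatFunc ℂ),
    g₂ ^ 3 - 27 * g₃ ^ 2 ≠ 0 ∧
    algebraMap ℂ[X] (RatFunc ℂ) ((curvePoly b).map (algebraMap ℝ ℂ)) * S ^ 2 =
      4 * R ^ 3 - RatFunc.C (g₂ : ℂ) * R - RatFunc.C (g₃ : ℂ) ∧
    R.denom.eval 0 = 0 ∧
    max R.num.natDegree R.denom.natDegree = N ∧
    ∀ᶠ z : ℂ in Filter.cofinite,
      ((R.num - C z * R.denom).roots.map
        (fun x => x * RatFunc.eval (RingHom.id ℂ) x S / ratFuncDerivEval R x)).sum = 0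

/-- Condition (A), in terms of `f_i = 1 / b_i`. -/
def ConditionA (f₁ f₂ f₃ f₄ : ℝ) : Prop :=
  81 * (f₂ ^ 2 + f₃ ^ 2) + 62 * (f₂ * f₃) + 36 * (f₁ + f₄) ^ 2
      - 108 * (f₂ + f₃) * (f₁ + f₄) = 0 ∧
  81 * (f₁ ^ 2 + f₄ ^ 2) + 62 * (f₁ * f₄) + 36 * (f₂ + f₃) ^ 2
      - 108 * (f₂ + f₃) * (f₁ + f₄) = 0

/-- Condition (B), in terms of `f_i = 1 / b_i`. -/
def ConditionB (f₁ f₂ f₃ f₄ : ℝ) : Prop :=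
  100 * f₄ * f₃ + 8 * f₁ * (f₄ + f₃ + 8 * f₁ - 9 * f₂) - (9 * f₄ + 9 * f₃ - 6 * f₂) ^ 2 = 0 ∧
  (6 * f₄ + 6 * f₃ - 9 * f₂) ^ 2 + 8 * f₁ * (9 * f₄ + 9 * f₃ - 8 * f₁ - f₂) = 0

end

/-!
In the coordinate `t = 1 / λ` the form `ω₂` is, up to a constant, `dt / y` on the curve
`y² = -t ∏ (t - f_k)`. Under (A) this form is the pullback of the invariant differential of an
elliptic curve by a covering of degree 4, so that an integral over an oval counts the passages of
the covering function across a half period: `[f₄, f₃]` is folded three times onto an interval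
between two branch values, and `[f₂, f₁]` is mapped once onto the same interval. Under (B) the
reflected points `f₁, f₁ - f₄, f₁ - f₃, f₁ - f₂` admit a covering of the same kind. It folds the
image of `[f₄, f₃]` twice onto the bounded half period of the other real form, and maps the image of
`[f₂, f₁]` once onto the unbounded one, which a translation by a point of order two carries to the
bounded one.
-/

open MeasureTheory Set

theorem integral_eq_add_of_mem_uIcc {E : Type*} [NormedAddCommGroup E] [NormedSpace ℝ E]
    {f : ℝ → E} {μ : Measure ℝ} {p q x : ℝ} (hf : IntervalIntegrable f μ p q)
    (hx : x ∈ uIcc p q) :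
    ∫ t in p..q, f t ∂μ = (∫ t in p..x, f t ∂μ) + ∫ t in x..q, f t ∂μ :=
  (intervalIntegral.integral_add_adjacent_intervals
    (hf.mono_set (uIcc_subset_uIcc left_mem_uIcc hx))
    (hf.mono_set (uIcc_subset_uIcc hx right_mem_uIcc))).symm

theorem intervalIntegrable_inv_sqrt_abs_mul {p q : ℝ} (hpq : p < q) :
    IntervalIntegrable (fun x => 1 / √|(x - p) * (x - q)|) volume p q := by
  have hl : 0 < q - p := sub_pos.2 hpq
  have hderiv (x : ℝ) : HasDerivAt (fun x => (2 * x - p - q) / (q - p)) (2 / (q - p)) x := by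
    simpa using ((((hasDerivAt_id x).const_mul 2).sub_const p).sub_const q).div_const (q - p)
  have hp : (2 * p - p - q) / (q - p) = -1 := by field_simp; ring
  have hq : (2 * q - p - q) / (q - p) = 1 := by field_simp; ring
  have hint := (intervalIntegral.integrable_comp_mul_deriv_iff_of_deriv_nonneg
    (a := p) (b := q) (g := fun y => √(1 - y ^ 2)⁻¹)
    (fun x _ => (hderiv x).continuousAt.continuousWithinAt)
    (fun x _ => hderiv x) (fun _ _ => (div_pos two_pos hl).le)).2
    (by simpa only [hp, hq] using Polynomial.Chebyshev.intervalIntegrable_sqrt_one_sub_sq_inv)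
  refine hint.congr fun x hx => ?_
  rw [uIoc_of_le hpq.le] at hx
  have hsq : 1 - ((2 * x - p - q) / (q - p)) ^ 2 =
      (2 / (q - p)) ^ 2 * |(x - p) * (x - q)| := by
    rw [abs_of_nonpos (mul_nonpos_of_nonneg_of_nonpos (by linarith [hx.1]) (by linarith [hx.2]))]
    field_simp
    ring
  simp only [Function.comp_apply]
  rw [hsq, Real.sqrt_inv, Real.sqrt_mul (sq_nonneg _), Real.sqrt_sq (div_pos two_pos hl).le]
  field_simp

theorem intervalIntegrable_div_sqrt_abs {p q : ℝ} (hpq : p < q) {P u v : ℝ → ℝ}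
    (hu : ContinuousOn u (Icc p q)) (hu₀ : ∀ x ∈ Icc p q, u x ≠ 0)
    (hv : ContinuousOn v (Icc p q)) (hP : ∀ x ∈ Icc p q, P x = (x - p) * (x - q) * u x) :
    IntervalIntegrable (fun x => v x / √|P x|) volume p q := by
  have hcont : ContinuousOn (fun x => v x / √|u x|) (uIcc p q) := by
    rw [uIcc_of_le hpq.le]
    exact hv.div hu.abs.sqrt fun x hx => (Real.sqrt_pos.2 (abs_pos.2 (hu₀ x hx))).ne'
  refine ((intervalIntegrable_inv_sqrt_abs_mul hpq).mul_continuousOn hcont).congr fun x hx => ?_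
  rw [uIoc_of_le hpq.le] at hx
  rw [hP x (Ioc_subset_Icc_self hx), abs_mul _ (u x), Real.sqrt_mul (abs_nonneg _),
    div_mul_div_comm, one_mul]

theorem integral_inv_sqrt_abs_of_pullback {p q : ℝ} (hpq : p ≤ q) {P C G G' : ℝ → ℝ}
    (hG : ContinuousOn G (Icc p q)) (hG' : ∀ t ∈ Ioo p q, HasDerivAt G (G' t) t)
    (hne : ∀ t ∈ Ioo p q, G' t ≠ 0) (hPC : ∀ t ∈ Ioo p q, C (G t) = P t * G' t ^ 2) :
    ∫ t in p..q, 1 / √|P t| = |(∫ w in G p..G q, 1 / √|C w|)| := by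
  have hdensity : ∀ t ∈ Ioo p q, 1 / √|P t| = |G' t| * (1 / √|C (G t)|) := fun t ht => by
    have hGt := abs_pos.2 (hne t ht)
    rw [hPC t ht, abs_mul, abs_pow, Real.sqrt_mul (abs_nonneg _), Real.sqrt_sq hGt.le]
    field_simp
  have hnonneg : 0 ≤ ∫ t in p..q, 1 / √|P t| :=
    intervalIntegral.integral_nonneg hpq fun _ _ => by positivity
  rw [← abs_of_nonneg hnonneg, abs_eq_abs]
  rw [← uIcc_of_le hpq] at hG
  rcases hasDerivWithinAt_forall_lt_or_forall_gt_of_forall_ne (convex_Ioo p q)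
    (fun t ht => (hG' t ht).hasDerivWithinAt) hne with hneg | hpos
  · right
    rw [← intervalIntegral.integral_deriv_smul_comp_of_deriv_nonpos hG
      (by simpa only [min_eq_left hpq, max_eq_right hpq] using hG')
      (by simpa only [min_eq_left hpq, max_eq_right hpq] using fun t ht => (hneg t ht).le),
      ← intervalIntegral.integral_neg]
    refine intervalIntegral.integral_congr_uIoo fun t ht => ?_
    rw [uIoo_of_le hpq] at ht
    simp only [hdensity t ht, abs_of_neg (hneg t ht), Function.comp_apply, smul_eq_mul, neg_mul]
  · left
    rw [← intervalIntegral.integral_deriv_smul_comp_of_deriv_nonneg hG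
      (by simpa only [min_eq_left hpq, max_eq_right hpq] using hG')
      (by simpa only [min_eq_left hpq, max_eq_right hpq] using fun t ht => (hpos t ht).le)]
    refine intervalIntegral.integral_congr_uIoo fun t ht => ?_
    rw [uIoo_of_le hpq] at ht
    simp only [hdensity t ht, abs_of_pos (hpos t ht), Function.comp_apply, smul_eq_mul]

/-- The polynomial `t ∏ (t - F_k)`; up to sign it defines the genus 2 curve with finite branch
points `0, F₁, F₂, F₃, F₄`. Periods over real ovals are written with `√|t ∏ (t - F_k)|`, which
serves both real forms `y² = ± t ∏ (t - F_k)` at once. -/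
def branchQuintic (F₁ F₂ F₃ F₄ t : ℝ) : ℝ := t * ((t - F₁) * (t - F₂) * (t - F₃) * (t - F₄))

theorem branchQuintic_sub (F₁ F₂ F₃ F₄ t : ℝ) :
    branchQuintic F₁ (F₁ - F₄) (F₁ - F₃) (F₁ - F₂) (F₁ - t) = -branchQuintic F₁ F₂ F₃ F₄ t := by
  simp only [branchQuintic]
  ring

theorem branchQuintic_one_div {b₁ b₂ b₃ b₄ x : ℝ} (h₁ : b₁ ≠ 0) (h₂ : b₂ ≠ 0) (h₃ : b₃ ≠ 0)
    (h₄ : b₄ ≠ 0) (hx : x ≠ 0) :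
    branchQuintic b₁ b₂ b₃ b₄ x =
      (x ^ 3) ^ 2 * ((b₁ * b₂ * b₃ * b₄) *
        branchQuintic (1 / b₁) (1 / b₂) (1 / b₃) (1 / b₄) (1 / x)) := by
  simp only [branchQuintic]
  field_simp
  ring

theorem integral_div_sqrt_abs_branchQuintic {b₁ b₂ b₃ b₄ p q : ℝ} (h₁ : b₁ ≠ 0) (h₂ : b₂ ≠ 0)
    (h₃ : b₃ ≠ 0) (h₄ : b₄ ≠ 0) (hp : 0 < p) (hpq : p ≤ q) :
    ∫ x in p..q, x / √|branchQuintic b₁ b₂ b₃ b₄ x| =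
      1 / √|b₁ * b₂ * b₃ * b₄| * ∫ t in (1 / q)..(1 / p),
        1 / √|branchQuintic (1 / b₁) (1 / b₂) (1 / b₃) (1 / b₄) t| := by
  have hpos : ∀ x ∈ uIcc p q, 0 < x := fun x hx => hp.trans_le (uIcc_of_le hpq ▸ hx).1
  have hsubst := intervalIntegral.integral_comp_mul_deriv_of_deriv_nonpos
    (a := p) (b := q) (f := fun x => 1 / x) (f' := fun x => -(x ^ 2)⁻¹)
    (g := fun t => 1 / √|branchQuintic (1 / b₁) (1 / b₂) (1 / b₃) (1 / b₄) t|)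
    (continuousOn_const.div continuousOn_id fun x hx => (hpos x hx).ne')
    (fun x hx => by simpa using hasDerivAt_inv (hpos x (Ioo_subset_Icc_self hx)).ne')
    (fun x _ => neg_nonpos.2 (inv_nonneg.2 (sq_nonneg x)))
  rw [intervalIntegral.integral_symm (1 / p), ← hsubst, ← intervalIntegral.integral_neg,
    ← intervalIntegral.integral_const_mul]
  refine intervalIntegral.integral_congr fun x hx => ?_
  have hx₀ := hpos x hx
  simp only [Function.comp_apply]
  rw [branchQuintic_one_div h₁ h₂ h₃ h₄ hx₀.ne', abs_mul, abs_mul (b₁ * b₂ * b₃ * b₄),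
    Real.sqrt_mul (abs_nonneg _), Real.sqrt_mul (abs_nonneg _), abs_sq,
    Real.sqrt_sq (pow_pos hx₀ 3).le]
  field_simp

theorem intervalIntegrable_div_sqrt_abs_branchQuintic {F₁ F₂ F₃ F₄ p q x y : ℝ} {v : ℝ → ℝ}
    (hv : ContinuousOn v (Icc p q)) (hp : 0 < p) (hpq : p < q) (hx : x ∉ Icc p q)
    (hy : y ∉ Icc p q) (hF : ∀ t, branchQuintic F₁ F₂ F₃ F₄ t = branchQuintic p q x y t) :
    IntervalIntegrable (fun t => v t / √|branchQuintic F₁ F₂ F₃ F₄ t|) volume p q := by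
  refine intervalIntegrable_div_sqrt_abs hpq (u := fun t => t * ((t - x) * (t - y)))
    (by fun_prop) (fun t ht => ?_) hv fun t _ => by rw [hF, branchQuintic]; ring
  exact mul_ne_zero (hp.trans_le ht.1).ne' (mul_ne_zero
    (sub_ne_zero.2 (ne_of_mem_of_not_mem ht hx)) (sub_ne_zero.2 (ne_of_mem_of_not_mem ht hy)))

section Cover

variable {F₁ F₂ F₃ F₄ r s t : ℝ}

/-- The numerator `t² - 3(r + s)t - 3rs` whose square gives the fibre of `coverFun` over
`-4r(r + 3s)²`. -/
def coverQuad (r s t : ℝ) : ℝ := t ^ 2 - 3 * (r + s) * t - 3 * (r * s)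

/-- The degree 4 rational function covering the `w`-line of the elliptic curve
`v² = coverCubic r s w`, in terms of its two finite critical points `r, s` at which it ramifies
over `0` and `4(s - r)³`. -/
noncomputable def coverFun (r s t : ℝ) : ℝ :=
  (t ^ 2 - (6 * s + 4 * r) * t + 9 * s ^ 2) * (t - r) ^ 2 / t

/-- The cubic of the elliptic curve covered by means of `coverFun`. The factor `9` makes `dw / v`
pull back to `dt / y` exactly. -/
def coverCubic (r s w : ℝ) : ℝ :=
  9 * (w * (w - 4 * (s - r) ^ 3) * (w + 4 * r * (r + 3 * s) ^ 2))

/-- The composition of `coverFun` with the translation of the elliptic curve by its point of order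
two over `w = -4r(r + 3s)²`. The translation takes `∞` to that point, so that this function is
regular at `t = 0`. -/
noncomputable def coverTranslate (r s t : ℝ) : ℝ :=
  16 * (r * s * (r + 3 * s) ^ 2 * (s + 3 * r) ^ 2) * t / coverQuad r s t ^ 2 -
    4 * r * (r + 3 * s) ^ 2

theorem hasDerivAt_coverQuad (r s t : ℝ) :
    HasDerivAt (coverQuad r s) (2 * t - 3 * (r + s)) t :=
  ((((hasDerivAt_id t).pow 2).sub
    ((hasDerivAt_id t).const_mul (3 * (r + s)))).sub_const (3 * (r * s))).congr_deriv (by simp)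

theorem hasDerivAt_coverFun (ht : t ≠ 0) :
    HasDerivAt (coverFun r s) (3 * ((t - r) * (t - s) * coverQuad r s t) / t ^ 2) t := by
  have hquad : HasDerivAt (fun t : ℝ => t ^ 2 - (6 * s + 4 * r) * t + 9 * s ^ 2)
      (2 * t - (6 * s + 4 * r)) t := by
    simpa using (((hasDerivAt_id t).pow 2).sub
      ((hasDerivAt_id t).const_mul (6 * s + 4 * r))).add_const (9 * s ^ 2)
  have hsq : HasDerivAt (fun t : ℝ => (t - r) ^ 2) (2 * (t - r)) t := by
    simpa using ((hasDerivAt_id' t).sub_const r).fun_pow 2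
  refine ((hquad.mul hsq).div (hasDerivAt_id t) ht).congr_deriv ?_
  simp only [coverQuad, id, Pi.mul_apply]
  field_simp
  ring

theorem hasDerivAt_coverTranslate (ht : coverQuad r s t ≠ 0) :
    HasDerivAt (coverTranslate r s)
      (-48 * (r * s * (r + 3 * s) ^ 2 * (s + 3 * r) ^ 2) * ((t - r) * (t - s)) /
        coverQuad r s t ^ 3) t := by
  refine ((((hasDerivAt_id t).const_mul (16 * (r * s * (r + 3 * s) ^ 2 * (s + 3 * r) ^ 2))).div
    ((hasDerivAt_coverQuad r s t).pow 2) (pow_ne_zero 2 ht)).sub_const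
      (4 * r * (r + 3 * s) ^ 2)).congr_deriv ?_
  simp only [id, Pi.pow_apply]
  field_simp
  simp only [coverQuad]
  ring

theorem coverFun_sub_const (ht : t ≠ 0) :
    coverFun r s t - 4 * (s - r) ^ 3 =
      (t ^ 2 - (6 * r + 4 * s) * t + 9 * r ^ 2) * (t - s) ^ 2 / t := by
  simp only [coverFun]
  field_simp
  ring

theorem coverFun_add_const (ht : t ≠ 0) :
    coverFun r s t + 4 * r * (r + 3 * s) ^ 2 = coverQuad r s t ^ 2 / t := by
  simp only [coverFun, coverQuad]
  field_simp
  ring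

theorem coverTranslate_eq (ht : coverQuad r s t ≠ 0) :
    coverTranslate r s t = -(4 * r * (r + 3 * s) ^ 2 *
      ((t ^ 2 - (6 * r + 4 * s) * t + 9 * r ^ 2) * (t - s) ^ 2) / coverQuad r s t ^ 2) := by
  simp only [coverTranslate]
  field_simp
  simp only [coverQuad]
  ring

theorem coverTranslate_add_const (r s t : ℝ) :
    coverTranslate r s t + 4 * r * (r + 3 * s) ^ 2 =
      16 * (r * s * (r + 3 * s) ^ 2 * (s + 3 * r) ^ 2) * t / coverQuad r s t ^ 2 :=
  sub_add_cancel _ _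

theorem coverTranslate_sub_const (ht : coverQuad r s t ≠ 0) :
    coverTranslate r s t - 4 * (s - r) ^ 3 = -(4 * s * (s + 3 * r) ^ 2 *
      ((t ^ 2 - (6 * s + 4 * r) * t + 9 * s ^ 2) * (t - r) ^ 2) / coverQuad r s t ^ 2) := by
  simp only [coverTranslate]
  field_simp
  simp only [coverQuad]
  ring

/-- Branch points `0 < F₄ < F₃ < F₂ < F₁` for which `coverFun r s` lifts to a degree 4 covering of
an elliptic curve by a curve `y² = ± branchQuintic F₁ F₂ F₃ F₄ t`: the simple zeros of `coverFun`
are `F₂, F₃`, and the simple points of its fibre over `4(s - r)³` are `F₁, F₄`. -/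
structure DegreeFourCover (F₁ F₂ F₃ F₄ r s : ℝ) : Prop where
  pos₄ : 0 < F₄
  lt₄₃ : F₄ < F₃
  lt₃₂ : F₃ < F₂
  lt₂₁ : F₂ < F₁
  add₂₃ : F₂ + F₃ = 6 * s + 4 * r
  mul₂₃ : F₂ * F₃ = 9 * s ^ 2
  add₁₄ : F₁ + F₄ = 6 * r + 4 * s
  mul₁₄ : F₁ * F₄ = 9 * r ^ 2

namespace DegreeFourCover

theorem pos₃ (h : DegreeFourCover F₁ F₂ F₃ F₄ r s) : 0 < F₃ := h.pos₄.trans h.lt₄₃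

theorem pos₂ (h : DegreeFourCover F₁ F₂ F₃ F₄ r s) : 0 < F₂ := h.pos₃.trans h.lt₃₂

theorem pos₁ (h : DegreeFourCover F₁ F₂ F₃ F₄ r s) : 0 < F₁ := h.pos₂.trans h.lt₂₁

theorem quad₂₃ (h : DegreeFourCover F₁ F₂ F₃ F₄ r s) (t : ℝ) :
    t ^ 2 - (6 * s + 4 * r) * t + 9 * s ^ 2 = (t - F₂) * (t - F₃) := by
  linear_combination t * h.add₂₃ - h.mul₂₃

theorem quad₁₄ (h : DegreeFourCover F₁ F₂ F₃ F₄ r s) (t : ℝ) :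
    t ^ 2 - (6 * r + 4 * s) * t + 9 * r ^ 2 = (t - F₁) * (t - F₄) := by
  linear_combination t * h.add₁₄ - h.mul₁₄

theorem coverCubic_coverFun (h : DegreeFourCover F₁ F₂ F₃ F₄ r s) (ht : t ≠ 0) :
    coverCubic r s (coverFun r s t) = branchQuintic F₁ F₂ F₃ F₄ t *
      (3 * ((t - r) * (t - s) * coverQuad r s t) / t ^ 2) ^ 2 := by
  rw [coverCubic, coverFun_sub_const ht, coverFun_add_const ht, coverFun, branchQuintic, h.quad₂₃,
    h.quad₁₄]
  field_simp
  ring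

theorem coverCubic_coverTranslate (h : DegreeFourCover F₁ F₂ F₃ F₄ r s)
    (ht : coverQuad r s t ≠ 0) :
    coverCubic r s (coverTranslate r s t) = branchQuintic F₁ F₂ F₃ F₄ t *
      (-48 * (r * s * (r + 3 * s) ^ 2 * (s + 3 * r) ^ 2) * ((t - r) * (t - s)) /
        coverQuad r s t ^ 3) ^ 2 := by
  rw [coverCubic, coverTranslate_sub_const ht, coverTranslate_add_const, coverTranslate_eq ht,
    branchQuintic, h.quad₂₃, h.quad₁₄]
  generalize coverQuad r s t = q, r + 3 * s = k, s + 3 * r = l, t - r = x, t - s = y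
  ring

theorem r_pos (h : DegreeFourCover F₁ F₂ F₃ F₄ r s) : 0 < r := by
  have hsq : 4 * r * F₂ = (F₂ - 3 * s) ^ 2 := by linear_combination -h.quad₂₃ F₂
  have hne : 9 * r ^ 2 ≠ 0 := h.mul₁₄ ▸ (mul_pos h.pos₁ h.pos₄).ne'
  have hnonneg : 0 ≤ 4 * r := nonneg_of_mul_nonneg_left (hsq ▸ sq_nonneg _) h.pos₂
  exact lt_of_le_of_ne (by linarith) fun hr => hne (by rw [← hr]; norm_num)

theorem s_pos (h : DegreeFourCover F₁ F₂ F₃ F₄ r s) : 0 < s := by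
  have hsq : 4 * s * F₁ = (F₁ - 3 * r) ^ 2 := by linear_combination -h.quad₁₄ F₁
  have hne : 9 * s ^ 2 ≠ 0 := h.mul₂₃ ▸ (mul_pos h.pos₂ h.pos₃).ne'
  have hnonneg : 0 ≤ 4 * s := nonneg_of_mul_nonneg_left (hsq ▸ sq_nonneg _) h.pos₁
  exact lt_of_le_of_ne (by linarith) fun hs => hne (by rw [← hs]; norm_num)

theorem r_lt_s (h : DegreeFourCover F₁ F₂ F₃ F₄ r s) : r < s := by
  have h₂ : 0 < (s - r) * (9 * (r + s) - 2 * F₂) := by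
    have := mul_pos (sub_pos.2 h.lt₂₁) (sub_pos.2 (h.lt₄₃.trans h.lt₃₂))
    linear_combination this - h.quad₂₃ F₂ + h.quad₁₄ F₂
  have h₃ : 0 < (s - r) * (9 * (r + s) - 2 * F₃) := by
    have := mul_pos (sub_pos.2 (h.lt₃₂.trans h.lt₂₁)) (sub_pos.2 h.lt₄₃)
    linear_combination this - h.quad₂₃ F₃ + h.quad₁₄ F₃
  have hsum : 0 < (s - r) * (6 * s + 10 * r) := by
    linear_combination h₂ + h₃ - 2 * (s - r) * h.add₂₃
  exact sub_pos.1 (pos_of_mul_pos_left hsum (by linarith [h.r_pos, h.s_pos]))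

theorem F₄_lt_r (h : DegreeFourCover F₁ F₂ F₃ F₄ r s) : F₄ < r := by
  have hquad : (F₁ - r) * (r - F₄) = 4 * r * (s - r) := by linear_combination h.quad₁₄ r
  have hr : r < F₁ := by linarith [h.add₁₄, h.lt₄₃, h.lt₃₂, h.lt₂₁, h.s_pos, h.r_pos]
  have hpos : 0 < (F₁ - r) * (r - F₄) :=
    hquad ▸ mul_pos (by linarith [h.r_pos]) (sub_pos.2 h.r_lt_s)
  exact sub_pos.1 (pos_of_mul_pos_right hpos (sub_pos.2 hr).le)

theorem s_lt_F₃ (h : DegreeFourCover F₁ F₂ F₃ F₄ r s) : s < F₃ := by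
  have hquad : (F₂ - s) * (F₃ - s) = 4 * s * (s - r) := by linear_combination -h.quad₂₃ s
  have hs : s < F₂ := by linarith [h.add₂₃, h.lt₃₂, h.s_pos, h.r_pos]
  have hpos : 0 < (F₂ - s) * (F₃ - s) :=
    hquad ▸ mul_pos (by linarith [h.s_pos]) (sub_pos.2 h.r_lt_s)
  exact sub_pos.1 (pos_of_mul_pos_right hpos (sub_pos.2 hs).le)

theorem coverQuad_of_quad₂₃ (h : DegreeFourCover F₁ F₂ F₃ F₄ r s) (ht : t = F₂ ∨ t = F₃) :
    coverQuad r s t = (3 * s + r) * (t - 3 * s) := by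
  have hzero : (t - F₂) * (t - F₃) = 0 := by rcases ht with rfl | rfl <;> simp
  rw [coverQuad]
  linear_combination hzero + h.quad₂₃ t

theorem exists_coverQuad_root (h : DegreeFourCover F₁ F₂ F₃ F₄ r s) :
    ∃ x ∈ Ioo F₃ F₂, ∀ t, 0 ≤ t → (coverQuad r s t = 0 ↔ t = x) := by
  have hr := h.r_pos
  have hs := h.s_pos
  have hF₃ : coverQuad r s F₃ < 0 := by
    rw [h.coverQuad_of_quad₂₃ (.inr rfl)]
    exact mul_neg_of_pos_of_neg (by positivity) (by nlinarith [h.mul₂₃, h.pos₃, h.lt₃₂])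
  have hF₂ : 0 < coverQuad r s F₂ := by
    rw [h.coverQuad_of_quad₂₃ (.inl rfl)]
    exact mul_pos (by positivity) (by nlinarith [h.mul₂₃, h.pos₃, h.lt₃₂])
  obtain ⟨x, hx, hx₀⟩ := intermediate_value_Ioo h.lt₃₂.le
    (fun t _ => (hasDerivAt_coverQuad r s t).continuousAt.continuousWithinAt) ⟨hF₃, hF₂⟩
  refine ⟨x, hx, fun t ht => ⟨fun ht₀ => ?_, fun htx => htx ▸ hx₀⟩⟩
  have hfactor : (x - t) * (t * x + 3 * (r * s)) = 0 := by
    rw [coverQuad] at hx₀ ht₀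
    linear_combination t * hx₀ - x * ht₀
  have hx_pos := h.pos₃.trans hx.1
  exact (sub_eq_zero.1 ((mul_eq_zero.1 hfactor).resolve_right (by positivity))).symm

theorem coverFun_eq_zero (h : DegreeFourCover F₁ F₂ F₃ F₄ r s) (ht : t = F₂ ∨ t = F₃ ∨ t = r) :
    coverFun r s t = 0 := by
  rw [coverFun, h.quad₂₃]
  rcases ht with rfl | rfl | rfl <;> simp

theorem coverFun_eq_const (h : DegreeFourCover F₁ F₂ F₃ F₄ r s)
    (ht : t = F₁ ∨ t = F₄ ∨ t = s) : coverFun r s t = 4 * (s - r) ^ 3 := by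
  have ht₀ : t ≠ 0 := by
    rcases ht with rfl | rfl | rfl
    exacts [h.pos₁.ne', h.pos₄.ne', h.s_pos.ne']
  rw [← sub_eq_zero, coverFun_sub_const ht₀, h.quad₁₄]
  rcases ht with rfl | rfl | rfl <;> simp

theorem integral_eq_abs_integral_coverCubic (h : DegreeFourCover F₁ F₂ F₃ F₄ r s) {p q : ℝ}
    (hp : 0 < p) (hpq : p ≤ q) (hr : r ∉ Ioo p q) (hs : s ∉ Ioo p q)
    (hQ : ∀ t ∈ Ioo p q, coverQuad r s t ≠ 0) :
    ∫ t in p..q, 1 / √|branchQuintic F₁ F₂ F₃ F₄ t| =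
      |(∫ w in coverFun r s p..coverFun r s q, 1 / √|coverCubic r s w|)| := by
  refine integral_inv_sqrt_abs_of_pullback hpq
    (fun t ht => (hasDerivAt_coverFun (hp.trans_le ht.1).ne').continuousAt.continuousWithinAt)
    (fun t ht => hasDerivAt_coverFun (hp.trans ht.1).ne') (fun t ht => ?_)
    (fun t ht => h.coverCubic_coverFun (hp.trans ht.1).ne')
  have hr' : t - r ≠ 0 := sub_ne_zero.2 (ne_of_mem_of_not_mem ht hr)
  have hs' : t - s ≠ 0 := sub_ne_zero.2 (ne_of_mem_of_not_mem ht hs)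
  have ht₀ : t ≠ 0 := (hp.trans ht.1).ne'
  have hQ' := hQ t ht
  positivity

theorem integral_zero_F₄ (h : DegreeFourCover F₁ F₂ F₃ F₄ r s) :
    ∫ t in (0 : ℝ)..F₄, 1 / √|branchQuintic F₁ F₂ F₃ F₄ t| =
      |(∫ w in -(4 * r * (r + 3 * s) ^ 2)..0, 1 / √|coverCubic r s w|)| := by
  have hr := h.r_pos
  have hs := h.s_pos
  obtain ⟨x, hx, hroot⟩ := h.exists_coverQuad_root
  have hQ : ∀ t ∈ Icc 0 F₄, coverQuad r s t ≠ 0 := fun t ht ht₀ => by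
    linarith [ht.2, h.lt₄₃, hx.1, (hroot t ht.1).1 ht₀]
  have hzero : coverTranslate r s 0 = -(4 * r * (r + 3 * s) ^ 2) := by simp [coverTranslate]
  have hF₄ : coverTranslate r s F₄ = 0 := by
    rw [coverTranslate_eq (hQ F₄ (right_mem_Icc.2 h.pos₄.le)), h.quad₁₄]
    simp
  rw [integral_inv_sqrt_abs_of_pullback h.pos₄.le
    (fun t ht => (hasDerivAt_coverTranslate (hQ t ht)).continuousAt.continuousWithinAt)
    (fun t ht => hasDerivAt_coverTranslate (hQ t (Ioo_subset_Icc_self ht))) (fun t ht => ?_)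
    (fun t ht => h.coverCubic_coverTranslate (hQ t (Ioo_subset_Icc_self ht))), hzero, hF₄]
  have htr : t - r ≠ 0 := (sub_neg.2 (ht.2.trans h.F₄_lt_r)).ne
  have hts : t - s ≠ 0 := (sub_neg.2 (ht.2.trans (h.F₄_lt_r.trans h.r_lt_s))).ne
  have hQ' := hQ t (Ioo_subset_Icc_self ht)
  positivity

theorem integral_eq_abs_integral_zero (h : DegreeFourCover F₁ F₂ F₃ F₄ r s) {p q a : ℝ}
    (hp : 0 < p) (hpq : p ≤ q) (hr : r ∉ Ioo p q) (hs : s ∉ Ioo p q)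
    (hQ : ∀ t ∈ Ioo p q, coverQuad r s t ≠ 0)
    (hG : coverFun r s p = 0 ∧ coverFun r s q = a ∨ coverFun r s p = a ∧ coverFun r s q = 0) :
    ∫ t in p..q, 1 / √|branchQuintic F₁ F₂ F₃ F₄ t| =
      |(∫ w in 0..a, 1 / √|coverCubic r s w|)| := by
  rw [h.integral_eq_abs_integral_coverCubic hp hpq hr hs hQ]
  rcases hG with ⟨hGp, hGq⟩ | ⟨hGp, hGq⟩
  · rw [hGp, hGq]
  · rw [hGp, hGq, intervalIntegral.integral_symm, abs_neg]

theorem integral_eq_three_mul (h : DegreeFourCover F₁ F₂ F₃ F₄ r s) :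
    ∫ t in F₄..F₃, 1 / √|branchQuintic F₁ F₂ F₃ F₄ t| =
      3 * ∫ t in F₂..F₁, 1 / √|branchQuintic F₁ F₂ F₃ F₄ t| := by
  have h₄r := h.F₄_lt_r
  have hrs := h.r_lt_s
  have hs₃ := h.s_lt_F₃
  obtain ⟨x, hx, hroot⟩ := h.exists_coverQuad_root
  have hlap {p q : ℝ} (hp : 0 < p) (hpq : p < q) (hr : r ∉ Ioo p q) (hs : s ∉ Ioo p q)
      (hx : x ∉ Ioo p q) := h.integral_eq_abs_integral_zero (a := 4 * (s - r) ^ 3) hp hpq.le hr hs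
    fun t ht ht₀ => hx ((hroot t (hp.trans ht.1).le).1 ht₀ ▸ ht)
  have hint : IntervalIntegrable (fun t => 1 / √|branchQuintic F₁ F₂ F₃ F₄ t|) volume F₄ F₃ :=
    intervalIntegrable_div_sqrt_abs_branchQuintic continuousOn_const h.pos₄ h.lt₄₃
      (notMem_Icc_of_gt h.lt₃₂) (notMem_Icc_of_gt (h.lt₃₂.trans h.lt₂₁))
      fun t => by simp only [branchQuintic]; ring
  have hs_mem : s ∈ uIcc F₄ F₃ := mem_uIcc_of_le (h₄r.trans hrs).le hs₃.le
  rw [integral_eq_add_of_mem_uIcc hint hs_mem,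
    integral_eq_add_of_mem_uIcc (hint.mono_set (uIcc_subset_uIcc_left hs_mem))
      (mem_uIcc_of_le h₄r.le hrs.le),
    hlap h.pos₄ h₄r (notMem_Ioo_of_ge le_rfl) (notMem_Ioo_of_ge hrs.le)
      (notMem_Ioo_of_ge (by linarith [hx.1]))
      (.inr ⟨h.coverFun_eq_const (.inr (.inl rfl)), h.coverFun_eq_zero (.inr (.inr rfl))⟩),
    hlap h.r_pos hrs (notMem_Ioo_of_le le_rfl) (notMem_Ioo_of_ge le_rfl)
      (notMem_Ioo_of_ge (by linarith [hx.1]))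
      (.inl ⟨h.coverFun_eq_zero (.inr (.inr rfl)), h.coverFun_eq_const (.inr (.inr rfl))⟩),
    hlap h.s_pos hs₃ (notMem_Ioo_of_le hrs.le) (notMem_Ioo_of_le le_rfl)
      (notMem_Ioo_of_ge hx.1.le)
      (.inr ⟨h.coverFun_eq_const (.inr (.inr rfl)), h.coverFun_eq_zero (.inr (.inl rfl))⟩),
    hlap h.pos₂ h.lt₂₁ (notMem_Ioo_of_le (by linarith [h.lt₃₂]))
      (notMem_Ioo_of_le (hs₃.trans h.lt₃₂).le) (notMem_Ioo_of_le hx.2.le)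
      (.inl ⟨h.coverFun_eq_zero (.inl rfl), h.coverFun_eq_const (.inl rfl)⟩)]
  ring

theorem integral_eq_two_mul (h : DegreeFourCover F₁ F₂ F₃ F₄ r s) :
    ∫ t in F₃..F₂, 1 / √|branchQuintic F₁ F₂ F₃ F₄ t| =
      2 * ∫ t in (0 : ℝ)..F₄, 1 / √|branchQuintic F₁ F₂ F₃ F₄ t| := by
  have hrs := h.r_lt_s
  have hs₃ := h.s_lt_F₃
  obtain ⟨x, hx, hroot⟩ := h.exists_coverQuad_root
  have hx_pos : 0 < x := h.pos₃.trans hx.1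
  have hlap {p q : ℝ} (hp : F₃ ≤ p) (hpq : p ≤ q) (hx : x ∉ Ioo p q) :=
    h.integral_eq_abs_integral_zero (a := -(4 * r * (r + 3 * s) ^ 2)) (h.pos₃.trans_le hp) hpq
      (notMem_Ioo_of_le (by linarith)) (notMem_Ioo_of_le (by linarith))
    fun t ht ht₀ => hx ((hroot t (h.pos₃.trans (hp.trans_lt ht.1)).le).1 ht₀ ▸ ht)
  have hint : IntervalIntegrable (fun t => 1 / √|branchQuintic F₁ F₂ F₃ F₄ t|) volume F₃ F₂ :=
    intervalIntegrable_div_sqrt_abs_branchQuintic continuousOn_const h.pos₃ h.lt₃₂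
      (notMem_Icc_of_gt h.lt₂₁) (notMem_Icc_of_lt h.lt₄₃)
      fun t => by simp only [branchQuintic]; ring
  have hval : coverFun r s x = -(4 * r * (r + 3 * s) ^ 2) := by
    rw [← add_eq_zero_iff_eq_neg, coverFun_add_const hx_pos.ne', (hroot x hx_pos.le).2 rfl]
    simp
  rw [integral_eq_add_of_mem_uIcc hint (mem_uIcc_of_le hx.1.le hx.2.le),
    hlap le_rfl hx.1.le (notMem_Ioo_of_ge le_rfl)
      (.inl ⟨h.coverFun_eq_zero (.inr (.inl rfl)), hval⟩),
    hlap hx.1.le hx.2.le (notMem_Ioo_of_le le_rfl)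
      (.inr ⟨hval, h.coverFun_eq_zero (.inl rfl)⟩),
    h.integral_zero_F₄, intervalIntegral.integral_symm, abs_neg]
  ring

end DegreeFourCover

end Cover

section Ratios

variable {f₁ f₂ f₃ f₄ : ℝ}

theorem ConditionA.degreeFourCover (h : ConditionA f₁ f₂ f₃ f₄) (h₄ : 0 < f₄) (h₄₃ : f₄ < f₃)
    (h₃₂ : f₃ < f₂) (h₂₁ : f₂ < f₁) :
    DegreeFourCover f₁ f₂ f₃ f₄ ((3 * (f₁ + f₄) - 2 * (f₂ + f₃)) / 10)
      ((3 * (f₂ + f₃) - 2 * (f₁ + f₄)) / 10) where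
  pos₄ := h₄
  lt₄₃ := h₄₃
  lt₃₂ := h₃₂
  lt₂₁ := h₂₁
  add₂₃ := by ring
  mul₂₃ := by linear_combination -h.1 / 100
  add₁₄ := by ring
  mul₁₄ := by linear_combination -h.2 / 100

theorem ConditionB.degreeFourCover (h : ConditionB f₁ f₂ f₃ f₄) (h₄ : 0 < f₄) (h₄₃ : f₄ < f₃)
    (h₃₂ : f₃ < f₂) (h₂₁ : f₂ < f₁) :
    DegreeFourCover f₁ (f₁ - f₄) (f₁ - f₃) (f₁ - f₂) ((2 * (f₃ + f₄) - 3 * f₂ + 2 * f₁) / 10)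
      ((2 * f₂ + 2 * f₁ - 3 * (f₃ + f₄)) / 10) where
  pos₄ := sub_pos.2 h₂₁
  lt₄₃ := sub_lt_sub_left h₃₂ f₁
  lt₃₂ := sub_lt_sub_left h₄₃ f₁
  lt₂₁ := sub_lt_self f₁ h₄
  add₂₃ := by ring
  mul₂₃ := by linear_combination h.1 / 100
  add₁₄ := by ring
  mul₁₄ := by linear_combination -h.2 / 100

theorem ConditionB.integral_eq_two_mul (h : ConditionB f₁ f₂ f₃ f₄) (h₄ : 0 < f₄) (h₄₃ : f₄ < f₃)
    (h₃₂ : f₃ < f₂) (h₂₁ : f₂ < f₁) :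
    ∫ t in f₄..f₃, 1 / √|branchQuintic f₁ f₂ f₃ f₄ t| =
      2 * ∫ t in f₂..f₁, 1 / √|branchQuintic f₁ f₂ f₃ f₄ t| := by
  have hreflect (p q : ℝ) : ∫ t in p..q, 1 / √|branchQuintic f₁ f₂ f₃ f₄ t| =
      ∫ t in (f₁ - q)..(f₁ - p), 1 / √|branchQuintic f₁ (f₁ - f₄) (f₁ - f₃) (f₁ - f₂) t| := by
    simp only [← intervalIntegral.integral_comp_sub_left, branchQuintic_sub, abs_neg]
  rw [hreflect, hreflect f₂, sub_self,
    (h.degreeFourCover h₄ h₄₃ h₃₂ h₂₁).integral_eq_two_mul]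

end Ratios

section Periods

variable {b : Fin 4 → ℝ}

theorem eval_curvePoly (b : Fin 4 → ℝ) (x : ℝ) :
    (curvePoly b).eval x = -branchQuintic (b 0) (b 1) (b 2) (b 3) x := by
  simp [curvePoly, branchQuintic, Fin.prod_univ_four]

theorem eval_curvePoly_nonneg₁ (h₀ : 0 < b 0) (hb : StrictMono b) {x : ℝ}
    (hx : x ∈ Icc (b 0) (b 1)) : 0 ≤ (curvePoly b).eval x := by
  have h₁₂ : b 1 < b 2 := hb (by decide)
  have h₂₃ : b 2 < b 3 := hb (by decide)
  have hfactor : (curvePoly b).eval x =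
      x * ((x - b 0) * (b 1 - x)) * ((b 2 - x) * (b 3 - x)) := by
    rw [eval_curvePoly, branchQuintic]
    ring
  rw [hfactor]
  exact mul_nonneg (mul_nonneg (h₀.le.trans hx.1) (mul_nonneg (sub_nonneg.2 hx.1)
    (sub_nonneg.2 hx.2))) (mul_nonneg (by linarith [hx.2]) (by linarith [hx.2]))

theorem eval_curvePoly_nonneg₂ (h₀ : 0 < b 0) (hb : StrictMono b) {x : ℝ}
    (hx : x ∈ Icc (b 2) (b 3)) : 0 ≤ (curvePoly b).eval x := by
  have h₀₁ : b 0 < b 1 := hb (by decide)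
  have h₁₂ : b 1 < b 2 := hb (by decide)
  have hfactor : (curvePoly b).eval x =
      x * ((x - b 2) * (b 3 - x)) * ((x - b 0) * (x - b 1)) := by
    rw [eval_curvePoly, branchQuintic]
    ring
  rw [hfactor]
  exact mul_nonneg (mul_nonneg (by linarith [hx.1]) (mul_nonneg (sub_nonneg.2 hx.1)
    (sub_nonneg.2 hx.2))) (mul_nonneg (by linarith [hx.1]) (by linarith [hx.1]))

theorem sqrt_eval_curvePoly {x : ℝ} (hx : 0 ≤ (curvePoly b).eval x) :
    √((curvePoly b).eval x) = √|branchQuintic (b 0) (b 1) (b 2) (b 3) x| := by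
  rw [← abs_of_nonneg hx, eval_curvePoly, abs_neg]

theorem alphaPeriod₁_eq (h₀ : 0 < b 0) (hb : StrictMono b) (j : ℕ) :
    alphaPeriod₁ b j =
      2 * ∫ x in (b 0)..(b 1), x ^ (j - 1) / √|branchQuintic (b 0) (b 1) (b 2) (b 3) x| := by
  rw [alphaPeriod₁]
  congr 1
  refine intervalIntegral.integral_congr fun x hx => ?_
  rw [uIcc_of_le (hb (by decide)).le] at hx
  simp only [sqrt_eval_curvePoly (eval_curvePoly_nonneg₁ h₀ hb hx)]

theorem alphaPeriod₂_eq (h₀ : 0 < b 0) (hb : StrictMono b) (j : ℕ) :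
    alphaPeriod₂ b j =
      2 * ∫ x in (b 2)..(b 3), x ^ (j - 1) / √|branchQuintic (b 0) (b 1) (b 2) (b 3) x| := by
  rw [alphaPeriod₂]
  congr 1
  refine intervalIntegral.integral_congr fun x hx => ?_
  rw [uIcc_of_le (hb (by decide)).le] at hx
  simp only [sqrt_eval_curvePoly (eval_curvePoly_nonneg₂ h₀ hb hx)]

theorem intervalIntegrable_pow_div_sqrt₁ (h₀ : 0 < b 0) (hb : StrictMono b) (n : ℕ) :
    IntervalIntegrable (fun x => x ^ n / √|branchQuintic (b 0) (b 1) (b 2) (b 3) x|) volume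
      (b 0) (b 1) :=
  intervalIntegrable_div_sqrt_abs_branchQuintic (by fun_prop) h₀ (hb (by decide))
    (notMem_Icc_of_gt (hb (by decide : (1 : Fin 4) < 2)))
    (notMem_Icc_of_gt (hb (by decide : (1 : Fin 4) < 3))) fun _ => rfl

theorem intervalIntegrable_pow_div_sqrt₂ (h₀ : 0 < b 0) (hb : StrictMono b) (n : ℕ) :
    IntervalIntegrable (fun x => x ^ n / √|branchQuintic (b 0) (b 1) (b 2) (b 3) x|) volume
      (b 2) (b 3) :=
  intervalIntegrable_div_sqrt_abs_branchQuintic (by fun_prop) (h₀.trans (hb (by decide)))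
    (hb (by decide)) (notMem_Icc_of_lt (hb (by decide : (0 : Fin 4) < 2)))
    (notMem_Icc_of_lt (hb (by decide : (1 : Fin 4) < 2)))
    fun x => by simp only [branchQuintic]; ring

theorem alphaPeriod₁_pos (h₀ : 0 < b 0) (hb : StrictMono b) (j : ℕ) : 0 < alphaPeriod₁ b j := by
  have h₀₁ : b 0 < b 1 := hb (by decide)
  rw [alphaPeriod₁_eq h₀ hb]
  refine mul_pos two_pos (intervalIntegral.intervalIntegral_pos_of_pos_on
    (intervalIntegrable_pow_div_sqrt₁ h₀ hb _) (fun x hx => ?_) h₀₁)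
  have hx₀ : 0 < x := h₀.trans hx.1
  have hne : ∀ i, x - b i ≠ 0 := fun i => by
    rcases (Fin.zero_le i).eq_or_lt with rfl | hi
    · exact (sub_pos.2 hx.1).ne'
    · exact (sub_neg.2 (hx.2.trans_le (hb.monotone (Fin.one_le_of_ne_zero hi.ne')))).ne
  refine div_pos (pow_pos hx₀ _) (Real.sqrt_pos.2 (abs_pos.2 ?_))
  exact mul_ne_zero hx₀.ne'
    (mul_ne_zero (mul_ne_zero (mul_ne_zero (hne 0) (hne 1)) (hne 2)) (hne 3))

theorem alphaPeriod₁_succ_le (h₀ : 0 < b 0) (hb : StrictMono b) (n : ℕ) :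
    alphaPeriod₁ b (n + 2) ≤ b 1 * alphaPeriod₁ b (n + 1) := by
  rw [alphaPeriod₁_eq h₀ hb, alphaPeriod₁_eq h₀ hb, mul_left_comm,
    ← intervalIntegral.integral_const_mul (b 1)]
  refine mul_le_mul_of_nonneg_left (intervalIntegral.integral_mono_on (hb (by decide)).le
    (intervalIntegrable_pow_div_sqrt₁ h₀ hb _)
    ((intervalIntegrable_pow_div_sqrt₁ h₀ hb _).const_mul _) fun x hx => ?_) two_pos.le
  rw [mul_div_assoc', Nat.add_sub_cancel, Nat.add_succ_sub_one, pow_succ']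
  have hx₀ : 0 ≤ x := h₀.le.trans hx.1
  gcongr
  exact hx.2

theorem mul_alphaPeriod₂_le (h₀ : 0 < b 0) (hb : StrictMono b) (n : ℕ) :
    b 2 * alphaPeriod₂ b (n + 1) ≤ alphaPeriod₂ b (n + 2) := by
  rw [alphaPeriod₂_eq h₀ hb, alphaPeriod₂_eq h₀ hb, mul_left_comm,
    ← intervalIntegral.integral_const_mul (b 2)]
  refine mul_le_mul_of_nonneg_left (intervalIntegral.integral_mono_on (hb (by decide)).le
    ((intervalIntegrable_pow_div_sqrt₂ h₀ hb _).const_mul _)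
    (intervalIntegrable_pow_div_sqrt₂ h₀ hb _) fun x hx => ?_) two_pos.le
  rw [mul_div_assoc', Nat.add_sub_cancel, Nat.add_succ_sub_one, pow_succ']
  have hx₀ : 0 ≤ x := (h₀.trans (hb (by decide))).le.trans hx.1
  gcongr
  exact hx.1

theorem realPeriodicity_of_mul_eq_mul (h₀ : 0 < b 0) (hb : StrictMono b) {m n : ℕ} (hn : 0 < n)
    (h : m * alphaPeriod₂ b 2 = n * alphaPeriod₁ b 2) : RealPeriodicity b := by
  have hn' : (0 : ℝ) < n := Nat.cast_pos.2 hn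
  have h₂ : 0 < b 2 := h₀.trans (hb (by decide))
  -- `λ ≤ b₂` on the first oval and `λ ≥ b₃ > b₂` on the second one, so that the period of `ω₁`
  -- over the cycle killed by `ω₂` is positive.
  have hlt : b 2 * (m * alphaPeriod₂ b 1) < b 2 * (n * alphaPeriod₁ b 1) := calc
    b 2 * (m * alphaPeriod₂ b 1) = m * (b 2 * alphaPeriod₂ b 1) := by ring
    _ ≤ m * alphaPeriod₂ b 2 := by gcongr; exact mul_alphaPeriod₂_le h₀ hb 0
    _ = n * alphaPeriod₁ b 2 := h
    _ ≤ n * (b 1 * alphaPeriod₁ b 1) := by gcongr; exact alphaPeriod₁_succ_le h₀ hb 0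
    _ = b 1 * (n * alphaPeriod₁ b 1) := by ring
    _ < b 2 * (n * alphaPeriod₁ b 1) :=
      mul_lt_mul_of_pos_right (hb (by decide)) (mul_pos hn' (alphaPeriod₁_pos h₀ hb 1))
  refine ⟨n, -m, n * alphaPeriod₁ b 1 - m * alphaPeriod₂ b 1, ?_,
    sub_pos.2 (lt_of_mul_lt_mul_left hlt h₂.le), ?_, ?_⟩
  · simp [hn.ne']
  · push_cast
    ring
  · push_cast
    linear_combination -h

theorem alphaPeriod₂_two_eq_mul (h₀ : 0 < b 0) (hb : StrictMono b) {k : ℝ}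
    (h : ∫ t in (1 / b 3)..(1 / b 2),
        1 / √|branchQuintic (1 / b 0) (1 / b 1) (1 / b 2) (1 / b 3) t| =
      k * ∫ t in (1 / b 1)..(1 / b 0),
        1 / √|branchQuintic (1 / b 0) (1 / b 1) (1 / b 2) (1 / b 3) t|) :
    alphaPeriod₂ b 2 = k * alphaPeriod₁ b 2 := by
  have hpos (i : Fin 4) : 0 < b i := h₀.trans_le (hb.monotone (Fin.zero_le i))
  simp only [alphaPeriod₁_eq h₀ hb, alphaPeriod₂_eq h₀ hb, Nat.add_one_sub_one, pow_one]
  rw [integral_div_sqrt_abs_branchQuintic (hpos 0).ne' (hpos 1).ne' (hpos 2).ne' (hpos 3).ne'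
      (hpos 2) (hb (by decide)).le,
    integral_div_sqrt_abs_branchQuintic (hpos 0).ne' (hpos 1).ne' (hpos 2).ne' (hpos 3).ne'
      (hpos 0) (hb (by decide)).le, h]
  ring

end Periods

section PeriodMapping

variable {a₁ a₂ a₃ c : ℝ}

theorem strictMono_branchPoints (ha₁₂ : a₁ < a₂) (ha₂₃ : a₂ < a₃) (hc₁ : a₁ < c) (hc₃ : c < a₃)
    (hc₂ : c ≠ a₂) : StrictMono (branchPoints a₁ a₂ a₃ c) := by
  refine Fin.strictMono_iff_lt_succ.2 fun i => ?_
  rcases hc₂.lt_or_gt with h | h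
  · fin_cases i <;> simp [branchPoints, *]
  · fin_cases i <;> simp [branchPoints, h.not_gt, *]

theorem branchPoints_zero (a₁ a₂ a₃ c : ℝ) : branchPoints a₁ a₂ a₃ c 0 = a₁ := by
  by_cases h : c < a₂ <;> simp [branchPoints, h]

theorem periodMapping_eq_of_lt {k : ℝ} (hc : c < a₂)
    (hα : alphaPeriod₁ (branchPoints a₁ a₂ a₃ c) 2 ≠ 0)
    (h : alphaPeriod₂ (branchPoints a₁ a₂ a₃ c) 2 = k * alphaPeriod₁ (branchPoints a₁ a₂ a₃ c) 2) :
    periodMapping a₁ a₂ a₃ c = k := by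
  rw [periodMapping, if_pos hc, h]
  field_simp

theorem periodMapping_eq_of_gt {k : ℝ} (hc : a₂ < c)
    (hα : alphaPeriod₁ (branchPoints a₁ a₂ a₃ c) 2 ≠ 0)
    (h : alphaPeriod₂ (branchPoints a₁ a₂ a₃ c) 2 = k * alphaPeriod₁ (branchPoints a₁ a₂ a₃ c) 2) :
    periodMapping a₁ a₂ a₃ c = 1 / k := by
  rw [periodMapping, if_neg hc.not_gt, h, mul_left_comm, div_mul_cancel_right₀ (by simpa), one_div]

end PeriodMapping

theorem proposition6p4_general (a₁ a₂ a₃ c : ℝ) (ha₁ : 0 < a₁) (ha₁₂ : a₁ < a₂) (ha₂₃ : a₂ < a₃)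
    (hc₁ : a₁ < c) (hc₃ : c < a₃) (hc₂ : c ≠ a₂)
    (b : Fin 4 → ℝ) (hb : b = branchPoints a₁ a₂ a₃ c) :
    (ConditionA (1 / b 0) (1 / b 1) (1 / b 2) (1 / b 3) →
      RealPeriodicity b ∧
      (c < a₂ → periodMapping a₁ a₂ a₃ c = 3) ∧
      (a₂ < c → periodMapping a₁ a₂ a₃ c = 1 / 3)) ∧
    (ConditionB (1 / b 0) (1 / b 1) (1 / b 2) (1 / b 3) →
      RealPeriodicity b ∧
      (c < a₂ → periodMapping a₁ a₂ a₃ c = 2) ∧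
      (a₂ < c → periodMapping a₁ a₂ a₃ c = 1 / 2)) := by
  have hmono : StrictMono b := hb ▸ strictMono_branchPoints ha₁₂ ha₂₃ hc₁ hc₃ hc₂
  have h₀ : 0 < b 0 := by rwa [hb, branchPoints_zero]
  have hpos (i : Fin 4) : 0 < b i := h₀.trans_le (hmono.monotone (Fin.zero_le i))
  have hlt {i j : Fin 4} (hij : i < j) : 1 / b j < 1 / b i :=
    one_div_lt_one_div_of_lt (hpos i) (hmono hij)
  have hα : alphaPeriod₁ b 2 ≠ 0 := (alphaPeriod₁_pos h₀ hmono 2).ne'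
  have h₃ : 0 < 1 / b 3 := one_div_pos.2 (hpos 3)
  have hratio {k : ℕ} (hk : 0 < k) (h : alphaPeriod₂ b 2 = k * alphaPeriod₁ b 2) :
      RealPeriodicity b ∧ (c < a₂ → periodMapping a₁ a₂ a₃ c = k) ∧
        (a₂ < c → periodMapping a₁ a₂ a₃ c = 1 / k) := by
    have hmul : (1 : ℕ) * alphaPeriod₂ b 2 = k * alphaPeriod₁ b 2 := by rwa [Nat.cast_one, one_mul]
    refine ⟨realPeriodicity_of_mul_eq_mul h₀ hmono hk hmul, ?_⟩
    subst hb
    exact ⟨fun hc => periodMapping_eq_of_lt hc hα h, fun hc => periodMapping_eq_of_gt hc hα h⟩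
  constructor
  · intro hA
    exact hratio three_pos <| alphaPeriod₂_two_eq_mul h₀ hmono (hA.degreeFourCover h₃
      (hlt (by decide)) (hlt (by decide)) (hlt (by decide))).integral_eq_three_mul
  · intro hB
    exact hratio two_pos <| alphaPeriod₂_two_eq_mul h₀ hmono <| hB.integral_eq_two_mul h₃
      (hlt (by decide)) (hlt (by decide)) (hlt (by decide))

theorem proposition6p4 (a₁ a₂ a₃ c : ℝ) (ha₁ : 0 < a₁) (ha₁₂ : a₁ < a₂) (ha₂₃ : a₂ < a₃)
    (hc₁ : a₁ < c) (hc₃ : c < a₃) (hc₂ : c ≠ a₂)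
    (b : Fin 4 → ℝ) (hb : b = branchPoints a₁ a₂ a₃ c)
    (hcover : IsRealTangentialCover b 4) :
    (ConditionA (1 / b 0) (1 / b 1) (1 / b 2) (1 / b 3) →
      RealPeriodicity b ∧
      (c < a₂ → periodMapping a₁ a₂ a₃ c = 3) ∧
      (a₂ < c → periodMapping a₁ a₂ a₃ c = 1 / 3)) ∧
    (ConditionB (1 / b 0) (1 / b 1) (1 / b 2) (1 / b 3) →
      RealPeriodicity b ∧
      (c < a₂ → periodMapping a₁ a₂ a₃ c = 2) ∧
      (a₂ < c → periodMapping a₁ a₂ a₃ c = 1 / 2)) :=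
  proposition6p4_general a₁ a₂ a₃ c ha₁ ha₁₂ ha₂₃ hc₁ hc₃ hc₂ b hb
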